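/- Let $I\subseteq\mathbb{R}$ be a proper interval, i.e. an interval (bounded or unbounded, with or without its endpoints) whose interior is nonempty. Let $F\colon I^2\to I$ be a map which is - bisymmetric: $F\big(F(x,y),F(u,v)\big)=F\big(F(x,u),F(y,v)\big)$ for all $x,y,u,v\in I$; - partially strictly increasing: for all fixed $x_0,y_0\in I$, the functions $x\mapsto F(x,y_0)$ and $y\mapsto F(x_0,y)$ are strictly increasing on $I$; - reflexive: $F(x,x)=x$ for all $x\in I$. Then exactly one of the following holds: either $F$ is symmetric everywhere on $I$, i.e. $F(x,y)=F(y,x)$ for all $x,y\in I$; or $F$ is nowhere symmetric on $I$, i.e. $F(x,y)\neq F(y,x)$ for all $x,y\in I$ with $x\neq y$. -/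

import Mathlib

/-- A proper interval of the real line: an order-convex set (bounded or not, with or without its
endpoints) whose interior is nonempty. -/
def IsProperInterval (I : Set ℝ) : Prop :=
  I.OrdConnected ∧ (interior I).Nonempty

namespace BinaryMap

/-- `F(x, x) = x` for every `x`. -/
def Reflexive {α : Type*} (F : α × α → α) : Prop :=
  ∀ x, F (x, x) = x

/-- Strictly increasing in each variable when the other one is fixed. -/
def PartiallyStrictlyIncreasing {α : Type*} [Preorder α] (F : α × α → α) : Prop :=
  (∀ y₀, StrictMono fun x => F (x, y₀)) ∧ (∀ x₀, StrictMono fun y => F (x₀, y))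

/-- `F(F(x, y), F(u, v)) = F(F(x, u), F(y, v))` for all `x, y, u, v`. -/
def Bisymmetric {α : Type*} (F : α × α → α) : Prop :=
  ∀ x y u v, F (F (x, y), F (u, v)) = F (F (x, u), F (y, v))

/-- Symmetric everywhere. -/
def Symmetric {α : Type*} (F : α × α → α) : Prop :=
  ∀ x y, F (x, y) = F (y, x)

/-- Nowhere symmetric: symmetric for no pair of distinct points. -/
def NowhereSymmetric {α : Type*} (F : α × α → α) : Prop :=
  ∀ x y, x ≠ y → F (x, y) ≠ F (y, x)

end BinaryMap

/-! Symmetry of a pair is an equivalence relation compatible with `F`, and `F` cancels in it.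
Suppose `a < b` is a symmetric pair. On the dyadic points it generates, `F` adds indices
(`map_dyadicPoint`). No continuity is assumed; a counting argument replaces it: uncountably many
disjoint nonempty open intervals cannot exist. This makes the dyadic points dense in `[a, b]`, so
`F` is symmetric on `[a, b]` and the classes are convex. If there were two classes, a densely
ordered set of representatives would produce such a family of intervals again. -/

namespace BinaryMap

/-! ### Bisymmetry identities and dyadic points -/

section Algebra

variable {α : Type*} {F : α × α → α}

/-- The pair `x, y` is a point of symmetry of `F`. -/
def SymmetricAt (F : α × α → α) (x y : α) : Prop :=
  F (x, y) = F (y, x)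

theorem SymmetricAt.symm {x y : α} (h : SymmetricAt F x y) : SymmetricAt F y x :=
  Eq.symm h

/-- Symmetric pairs form a subalgebra of the square. -/
theorem SymmetricAt.map (hbis : Bisymmetric F) {x y u v : α} (h : SymmetricAt F x y)
    (h' : SymmetricAt F u v) : SymmetricAt F (F (x, u)) (F (y, v)) := by
  unfold SymmetricAt at *
  rw [hbis, h, h', hbis]

/-- After distributing `c = F (c, c)`, `q` and `s` are the two middle entries of one bisymmetric
block, so they can be swapped. -/
theorem bisymmetric_exchange (hbis : Bisymmetric F) (hrefl : Reflexive F) (c p q r s : α) :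
    F (F (c, F (p, q)), F (F (r, s), c)) = F (F (c, F (p, s)), F (F (r, q), c)) := by
  have key : ∀ q s, F (F (c, F (p, q)), F (F (r, s), c)) =
      F (F (F (c, p), F (r, c)), F (F (c, q), F (s, c))) := by
    intro q s
    have h1 : F (c, F (p, q)) = F (F (c, p), F (c, q)) := by
      conv_lhs => rw [← hrefl c]
      rw [hbis]
    have h2 : F (F (r, s), c) = F (F (r, c), F (s, c)) := by
      conv_lhs => rw [← hrefl c]
      rw [hbis]
    rw [h1, h2, hbis]
  rw [key, key, hbis c q s c]

/-- The dyadic points generated by `a` and `b`: the `n`-th level refines the previous one by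
inserting the values of `F` at consecutive points. -/
def dyadicPoint (F : α × α → α) (a b : α) : ℕ → ℕ → α
  | 0, k => if k = 0 then a else b
  | n + 1, k => F (dyadicPoint F a b n (k / 2), dyadicPoint F a b n ((k + 1) / 2))

theorem dyadicPoint_succ_two_mul (hrefl : Reflexive F) (a b : α) (n k : ℕ) :
    dyadicPoint F a b (n + 1) (2 * k) = dyadicPoint F a b n k := by
  rw [dyadicPoint, show 2 * k / 2 = k by omega, show (2 * k + 1) / 2 = k by omega, hrefl]

theorem dyadicPoint_succ_two_mul_add_one (a b : α) (n k : ℕ) :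
    dyadicPoint F a b (n + 1) (2 * k + 1) =
      F (dyadicPoint F a b n k, dyadicPoint F a b n (k + 1)) := by
  rw [dyadicPoint, show (2 * k + 1) / 2 = k by omega, show (2 * k + 1 + 1) / 2 = k + 1 by omega]

theorem dyadicPoint_add_mul_two_pow (hrefl : Reflexive F) (a b : α) (n m k : ℕ) :
    dyadicPoint F a b (n + m) (k * 2 ^ m) = dyadicPoint F a b n k := by
  induction m with
  | zero => simp
  | succ m ih =>
    rw [← ih, ← add_assoc, pow_succ, ← dyadicPoint_succ_two_mul hrefl a b (n + m)]
    congr 1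
    ring

theorem map_dyadicPoint (hbis : Bisymmetric F) (hrefl : Reflexive F) {a b : α}
    (hab : SymmetricAt F a b) (n : ℕ) : ∀ i j, i ≤ 2 ^ n → j ≤ 2 ^ n →
      F (dyadicPoint F a b n i, dyadicPoint F a b n j) = dyadicPoint F a b (n + 1) (i + j) := by
  induction n with
  | zero =>
    intro i j hi hj
    have hi' : i = 0 ∨ i = 1 := by simp at hi; omega
    have hj' : j = 0 ∨ j = 1 := by simp at hj; omega
    rcases hi' with rfl | rfl <;> rcases hj' with rfl | rfl <;> simp [dyadicPoint]
    exact hab.symm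
  | succ n ih =>
    have hodd : ∀ i j, i ≤ 2 ^ n → j + 1 ≤ 2 ^ n →
        F (dyadicPoint F a b n i, F (dyadicPoint F a b n j, dyadicPoint F a b n (j + 1))) =
          dyadicPoint F a b (n + 2) (2 * (i + j) + 1) := by
      intro i j hi hj
      conv_lhs => rw [← hrefl (dyadicPoint F a b n i)]
      rw [hbis, ih _ _ hi (by omega), ih _ _ hi hj, dyadicPoint_succ_two_mul_add_one, add_assoc]
    have hodd' : ∀ i j, i ≤ 2 ^ n → j + 1 ≤ 2 ^ n →
        F (F (dyadicPoint F a b n j, dyadicPoint F a b n (j + 1)), dyadicPoint F a b n i) =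
          dyadicPoint F a b (n + 2) (2 * (i + j) + 1) := by
      intro i j hi hj
      conv_lhs => rw [← hrefl (dyadicPoint F a b n i)]
      rw [hbis, ih _ _ (by omega) hi, ih _ _ hj hi, dyadicPoint_succ_two_mul_add_one]
      congr 3 <;> omega
    intro i j hi hj
    rw [pow_succ] at hi hj
    obtain ⟨i, rfl | rfl⟩ := Nat.even_or_odd' i <;> obtain ⟨j, rfl | rfl⟩ := Nat.even_or_odd' j
    · rw [dyadicPoint_succ_two_mul hrefl, dyadicPoint_succ_two_mul hrefl, ← mul_add,
        dyadicPoint_succ_two_mul hrefl, ih _ _ (by omega) (by omega)]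
    · rw [dyadicPoint_succ_two_mul hrefl, dyadicPoint_succ_two_mul_add_one,
        hodd _ _ (by omega) (by omega)]
      congr 1
      ring
    · rw [dyadicPoint_succ_two_mul hrefl, dyadicPoint_succ_two_mul_add_one,
        hodd' _ _ (by omega) (by omega)]
      congr 1
      ring
    -- By induction the neighbours `j`, `j + 1` commute. After swapping them, bisymmetry pairs `i`
    -- with `j + 1` and `i + 1` with `j`: equal sums, so reflexivity applies.
    · rw [dyadicPoint_succ_two_mul_add_one, dyadicPoint_succ_two_mul_add_one,
        ih j (j + 1) (by omega) (by omega), add_comm j, ← ih (j + 1) j (by omega) (by omega), hbis,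
        ih _ _ (by omega) (by omega), ih _ _ (by omega) (by omega),
        show i + 1 + j = i + (j + 1) by omega, hrefl,
        show 2 * i + 1 + (2 * j + 1) = 2 * (i + (j + 1)) by omega, dyadicPoint_succ_two_mul hrefl]

end Algebra

/-! ### Cancellation and monotonicity -/

section Order

variable {α : Type*} [LinearOrder α] {F : α × α → α}

theorem PartiallyStrictlyIncreasing.map_le_map (hinc : PartiallyStrictlyIncreasing F)
    {x x' y y' : α} (hx : x ≤ x') (hy : y ≤ y') : F (x, y) ≤ F (x', y') :=
  ((hinc.1 y).monotone hx).trans ((hinc.2 x').monotone hy)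

theorem PartiallyStrictlyIncreasing.lt_map (hinc : PartiallyStrictlyIncreasing F)
    (hrefl : Reflexive F) {x y : α} (h : x < y) : x < F (x, y) := by
  have := hinc.2 x h
  simpa only [hrefl x] using this

theorem PartiallyStrictlyIncreasing.map_lt (hinc : PartiallyStrictlyIncreasing F)
    (hrefl : Reflexive F) {x y : α} (h : x < y) : F (x, y) < y := by
  have := hinc.1 y h
  simpa only [hrefl y] using this

/-- Cancellation: the left factor of a product of pairs can be removed from a symmetric pair. -/
theorem SymmetricAt.of_map_left (hbis : Bisymmetric F) (hinc : PartiallyStrictlyIncreasing F)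
    {x y u : α} (h : SymmetricAt F (F (u, x)) (F (u, y))) : SymmetricAt F x y := by
  unfold SymmetricAt at *
  rw [hbis, hbis u y] at h
  exact (hinc.2 _).injective h

/-- Padding with copies of `y` lets the exchange identity split `x` from `z`; each is then commuted
with `y`, and the two are recombined in the opposite order. -/
theorem SymmetricAt.trans (hbis : Bisymmetric F) (hinc : PartiallyStrictlyIncreasing F)
    (hrefl : Reflexive F) {x y z : α} (hxy : SymmetricAt F x y) (hyz : SymmetricAt F y z) :
    SymmetricAt F x z := by
  have h : F (F (y, F (x, z)), F (F (y, y), y)) = F (F (y, F (z, x)), F (F (y, y), y)) := by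
    rw [← bisymmetric_exchange hbis hrefl y x y y z, hxy, hyz, hbis y (F (y, x)) (F (z, y)) y,
      bisymmetric_exchange hbis hrefl y z y y x]
  exact (hinc.2 y).injective ((hinc.1 _).injective h)

theorem monotone_dyadicPoint (hinc : PartiallyStrictlyIncreasing F) {a b : α} (hab : a ≤ b)
    (n : ℕ) : Monotone (dyadicPoint F a b n) := by
  induction n with
  | zero =>
    intro i j hij
    simp only [dyadicPoint]
    split_ifs <;> first | exact le_rfl | exact hab | omega
  | succ n ih =>
    intro i j hij
    exact hinc.map_le_map (ih (by omega)) (ih (by omega))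

theorem dyadicPoint_le_dyadicPoint (hinc : PartiallyStrictlyIncreasing F) (hrefl : Reflexive F)
    {a b : α} (hab : a ≤ b) {n m k l : ℕ} (h : k * 2 ^ m ≤ l * 2 ^ n) :
    dyadicPoint F a b n k ≤ dyadicPoint F a b m l := by
  rw [← dyadicPoint_add_mul_two_pow hrefl a b n m k, ← dyadicPoint_add_mul_two_pow hrefl a b m n l,
    add_comm m n]
  exact monotone_dyadicPoint hinc hab _ h

/-- If no dyadic point lies strictly between `x` and `y`, both lie between two consecutive
dyadic points of any level. -/
theorem exists_dyadicPoint_bracket {a b x y : α} (hrefl : Reflexive F) (hx : a ≤ x) (hy : y ≤ b)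
    (h : ∀ n k, dyadicPoint F a b n k ≤ x ∨ y ≤ dyadicPoint F a b n k) (n : ℕ) :
    ∃ k, k + 1 ≤ 2 ^ n ∧ dyadicPoint F a b n k ≤ x ∧ y ≤ dyadicPoint F a b n (k + 1) := by
  induction n with
  | zero => exact ⟨0, by simp, by simpa [dyadicPoint] using hx, by simpa [dyadicPoint] using hy⟩
  | succ n ih =>
    obtain ⟨k, hk, h1, h2⟩ := ih
    rw [pow_succ]
    rcases h (n + 1) (2 * k + 1) with h3 | h3
    · exact ⟨2 * k + 1, by omega, h3, by
        rwa [show 2 * k + 1 + 1 = 2 * (k + 1) by ring, dyadicPoint_succ_two_mul hrefl]⟩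
    · exact ⟨2 * k, by omega, by rwa [dyadicPoint_succ_two_mul hrefl], h3⟩

end Order

/-! ### Density and convexity by counting intervals -/

section Complete

variable {α : Type*} [ConditionallyCompleteLinearOrder α] {F : α × α → α}

/-- A choice of points at all real positions between the dyadic points. -/
theorem exists_dyadicPoint_separated (hinc : PartiallyStrictlyIncreasing F) (hrefl : Reflexive F)
    {a b : α} (hab : a ≤ b) :
    ∃ z : ℝ → α, ∀ s ∈ Set.Ioo (0 : ℝ) 1, ∀ t ∈ Set.Ioo (0 : ℝ) 1, s < t →
      ∃ n j, j + 1 ≤ 2 ^ n ∧ z s ≤ dyadicPoint F a b n j ∧ dyadicPoint F a b n (j + 1) ≤ z t := by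
  have hbound : ∀ (s : ℝ) (n m : ℕ), 0 < s →
      dyadicPoint F a b m ⌊s * 2 ^ m⌋₊ ≤ dyadicPoint F a b n (⌊s * 2 ^ n⌋₊ + 1) := by
    intro s n m hs
    apply dyadicPoint_le_dyadicPoint hinc hrefl hab
    have h1 : (⌊s * 2 ^ m⌋₊ : ℝ) ≤ s * 2 ^ m := Nat.floor_le (by positivity)
    have h2 : s * 2 ^ n < (⌊s * 2 ^ n⌋₊ : ℝ) + 1 := Nat.lt_floor_add_one _
    have h3 : (⌊s * 2 ^ m⌋₊ : ℝ) * 2 ^ n ≤ (⌊s * 2 ^ n⌋₊ + 1) * 2 ^ m :=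
      calc (⌊s * 2 ^ m⌋₊ : ℝ) * 2 ^ n ≤ s * 2 ^ m * 2 ^ n := by gcongr
        _ = s * 2 ^ n * 2 ^ m := by ring
        _ ≤ _ := by gcongr
    exact_mod_cast h3
  refine ⟨fun s => ⨆ n, dyadicPoint F a b n ⌊s * 2 ^ n⌋₊, fun s hs t ht hst => ?_⟩
  -- A gap of more than 2 at level `n` leaves room for two consecutive indices.
  obtain ⟨n, hn⟩ := pow_unbounded_of_one_lt (2 / (t - s)) (one_lt_two (α := ℝ))
  rw [div_lt_iff₀ (by linarith)] at hn
  have hle : ⌊s * 2 ^ n⌋₊ + 1 + 1 ≤ ⌊t * 2 ^ n⌋₊ := by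
    apply Nat.le_floor
    have h1 : (⌊s * 2 ^ n⌋₊ : ℝ) ≤ s * 2 ^ n := Nat.floor_le (by have := hs.1; positivity)
    push_cast
    nlinarith
  have hfl : ⌊t * 2 ^ n⌋₊ ≤ 2 ^ n := by
    apply Nat.floor_le_of_le
    push_cast
    have : (0 : ℝ) < 2 ^ n := by positivity
    nlinarith [ht.2]
  refine ⟨n, ⌊s * 2 ^ n⌋₊ + 1, hle.trans hfl, ciSup_le fun m => hbound s n m hs.1, ?_⟩
  have hbdd : BddAbove (Set.range fun n => dyadicPoint F a b n ⌊t * 2 ^ n⌋₊) :=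
    ⟨_, Set.forall_mem_range.2 fun m => hbound t 0 m ht.1⟩
  exact (monotone_dyadicPoint hinc hab n hle).trans (le_ciSup hbdd n)

variable [TopologicalSpace α] [OrderTopology α] [SecondCountableTopology α]
  [DenselyOrdered α]

theorem not_pairwiseDisjoint_Ioo {S : Set ℝ} (hS : ¬ S.Countable) (u v : ℝ → α)
    (huv : ∀ s ∈ S, u s < v s) (hdisj : ∀ s ∈ S, ∀ t ∈ S, s < t → v s ≤ u t) : False := by
  refine hS (Set.PairwiseDisjoint.countable_of_isOpen (s := fun s => Set.Ioo (u s) (v s)) ?_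
    (fun _ _ => isOpen_Ioo) fun s hs => Set.nonempty_Ioo.2 (huv s hs))
  have key : ∀ s ∈ S, ∀ t ∈ S, s < t → Disjoint (Set.Ioo (u s) (v s)) (Set.Ioo (u t) (v t)) :=
    fun s hs t ht hst => Set.disjoint_left.2 fun w hw hw' =>
      (hw.2.trans_le (hdisj s hs t ht hst)).not_gt hw'.1
  intro s hs t ht hne
  rcases hne.lt_or_gt with h | h
  · exact key s hs t ht h
  · exact (key t ht s hs h).symm

/-- The dyadic points generated by a symmetric pair are dense. -/
theorem exists_dyadicPoint_between (hbis : Bisymmetric F) (hinc : PartiallyStrictlyIncreasing F)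
    (hrefl : Reflexive F) {a b x y : α} (hab : SymmetricAt F a b) (hx : a ≤ x) (hxy : x < y)
    (hy : y ≤ b) : ∃ n k, x < dyadicPoint F a b n k ∧ dyadicPoint F a b n k < y := by
  by_contra! h
  have h' : ∀ n k, dyadicPoint F a b n k ≤ x ∨ y ≤ dyadicPoint F a b n k := fun n k =>
    (le_or_gt (dyadicPoint F a b n k) x).imp_right (h n k)
  obtain ⟨z, hz⟩ := exists_dyadicPoint_separated hinc hrefl (hx.trans (hxy.le.trans hy))
  refine not_pairwiseDisjoint_Ioo (S := Set.Ioo (0 : ℝ) 1)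
    (Cardinal.Real.Ioo_countable_iff.not.2 (by norm_num)) (fun s => F (x, z s))
    (fun s => F (y, z s)) (fun s _ => hinc.1 _ hxy) fun s hs t ht hst => ?_
  obtain ⟨n, j, hj, hs', ht'⟩ := hz s hs t ht hst
  obtain ⟨k, hk, hkx, hky⟩ := exists_dyadicPoint_bracket hrefl hx hy h' n
  -- Moving one index step from the first argument to the second keeps the index sum.
  calc F (y, z s) ≤ F (dyadicPoint F a b n (k + 1), dyadicPoint F a b n j) :=
        hinc.map_le_map hky hs'
    _ = F (dyadicPoint F a b n k, dyadicPoint F a b n (j + 1)) := by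
        rw [map_dyadicPoint hbis hrefl hab n _ _ hk (by omega),
          map_dyadicPoint hbis hrefl hab n _ _ (by omega) hj]
        congr 1
        ring
    _ ≤ F (x, z t) := hinc.map_le_map hkx ht'

/-- Points of an interval with symmetric endpoints form symmetric pairs with each other. -/
theorem SymmetricAt.of_mem_Icc (hbis : Bisymmetric F) (hinc : PartiallyStrictlyIncreasing F)
    (hrefl : Reflexive F) {a b x y : α} (hab : SymmetricAt F a b) (hx : x ∈ Set.Icc a b)
    (hy : y ∈ Set.Icc a b) : SymmetricAt F x y := by
  have hle : a ≤ b := hx.1.trans hx.2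
  have key : ∀ x ∈ Set.Icc a b, ∀ y ∈ Set.Icc a b, ¬ F (x, y) < F (y, x) := by
    intro x hx y hy hlt
    have hlow : a ≤ F (x, y) := (hrefl a).symm.le.trans (hinc.map_le_map hx.1 hy.1)
    have hupp : F (y, x) ≤ b := (hinc.map_le_map hy.2 hx.2).trans (hrefl b).le
    obtain ⟨n, k, h1, h2⟩ := exists_dyadicPoint_between hbis hinc hrefl hab hlow hlt hupp
    -- Two dyadic points are needed: the bounds `i + j` and `i + j + 2` found below leave room for
    -- only one index.
    obtain ⟨m, l, h3, h4⟩ :=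
      exists_dyadicPoint_between hbis hinc hrefl hab (hlow.trans h1.le) h2 hupp
    have hbr : ∀ w ∈ Set.Icc a b, ∃ i, i + 1 ≤ 2 ^ (n + m) ∧ dyadicPoint F a b (n + m) i ≤ w ∧
        w ≤ dyadicPoint F a b (n + m) (i + 1) := fun w hw =>
      exists_dyadicPoint_bracket hrefl hw.1 hw.2 (fun _ _ => le_total _ _) _
    obtain ⟨i, hi, hix, hix'⟩ := hbr x hx
    obtain ⟨j, hj, hjy, hjy'⟩ := hbr y hy
    have hlo := hinc.map_le_map hix hjy
    have hup := hinc.map_le_map hjy' hix'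
    rw [map_dyadicPoint hbis hrefl hab _ _ _ (by omega) (by omega)] at hlo hup
    rw [← dyadicPoint_add_mul_two_pow hrefl a b n (m + 1) k, ← add_assoc] at h1 h3
    rw [← dyadicPoint_add_mul_two_pow hrefl a b m (n + 1) l, ← add_assoc, add_comm m n] at h3 h4
    have hmono := monotone_dyadicPoint hinc hle (n + m + 1)
    have e1 := hmono.reflect_lt (hlo.trans_lt h1)
    have e2 := hmono.reflect_lt h3
    have e3 := hmono.reflect_lt (h4.trans_le hup)
    omega
  exact le_antisymm (not_lt.1 (key y hy x hx)) (not_lt.1 (key x hx y hy))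

/-- If some pair of distinct points is symmetric, then all pairs are. -/
theorem symmetric_of_symmetricAt (hbis : Bisymmetric F) (hinc : PartiallyStrictlyIncreasing F)
    (hrefl : Reflexive F) {a b : α} (hlt : a < b) (hab : SymmetricAt F a b) : Symmetric F := by
  by_contra hsymm
  simp only [Symmetric, not_forall] at hsymm
  obtain ⟨x₀, y₀, hne⟩ := hsymm
  have hconv : ∀ {x y z : α}, x ≤ y → y ≤ z → SymmetricAt F x z → SymmetricAt F x y :=
    fun hxy hyz h => h.of_mem_Icc hbis hinc hrefl ⟨le_rfl, hxy.trans hyz⟩ ⟨hxy, hyz⟩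
  have hconv' : ∀ {x y z : α}, x ≤ y → y ≤ z → SymmetricAt F x z → SymmetricAt F y z :=
    fun hxy hyz h => h.of_mem_Icc hbis hinc hrefl ⟨hxy, hyz⟩ ⟨hxy.trans hyz, le_rfl⟩
  let r : Setoid α :=
    ⟨SymmetricAt F, fun _ => rfl, fun h => h.symm, fun h h' => h.trans hbis hinc hrefl h'⟩
  let T : Set α := Set.range (Quotient.out : Quotient r → α)
  have hrep : ∀ x, ∃ t : T, SymmetricAt F t x := fun x =>
    ⟨⟨_, Set.mem_range_self (Quotient.mk r x)⟩, Quotient.mk_out (s := r) x⟩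
  have huniq : ∀ t t' : T, SymmetricAt F t t' → t = t' := by
    rintro ⟨_, p, rfl⟩ ⟨_, q, rfl⟩ h
    exact Subtype.ext (congrArg Quotient.out (Quotient.out_equiv_out.1 h))
  have hnontriv : Nontrivial T := by
    obtain ⟨t, ht⟩ := hrep x₀
    obtain ⟨t', ht'⟩ := hrep y₀
    refine ⟨t, t', fun h => hne ?_⟩
    subst h
    exact ht.symm.trans hbis hinc hrefl ht'
  -- By cancellation `F (t, t')` lies in neither class; by convexity its representative lies
  -- strictly between `t` and `t'`.
  have hdense : DenselyOrdered T := by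
    refine ⟨fun t t' htt' => ?_⟩
    obtain ⟨m, hm⟩ := hrep (F (t, t'))
    have hlt' : (t : α) < t' := htt'
    have h1 : ¬ SymmetricAt F t (F (t, t')) := fun h => by
      refine htt'.ne (huniq t t' (SymmetricAt.of_map_left hbis hinc (u := t) ?_))
      rwa [hrefl]
    have h2 : ¬ SymmetricAt F (F (t, t')) t' := fun h => by
      refine htt'.ne (huniq t t' ?_)
      have h3 : SymmetricAt F (F (t, t')) (F (t', t')) := by rwa [hrefl]
      unfold SymmetricAt at h3 ⊢
      rw [hbis, hbis t' t' t t'] at h3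
      exact (hinc.1 _).injective h3
    refine ⟨m, ?_, ?_⟩
    · by_contra! h
      exact h1 (hconv' h (hinc.lt_map hrefl hlt').le hm)
    · by_contra! h
      exact h2 (hconv (hinc.map_lt hrefl hlt').le h hm.symm)
  obtain ⟨e⟩ := Order.embedding_from_countable_to_dense ℚ T
  have hz : ∀ s : ℝ, ∃ z : α, ∀ q : ℚ, ((q : ℝ) < s → (e q : α) ≤ z) ∧ (s < q → z ≤ e q) := by
    intro s
    obtain ⟨q₀, hq₀⟩ := exists_rat_lt s
    obtain ⟨q₁, hq₁⟩ := exists_rat_gt s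
    have hub : ∀ q : ℚ, s < q → (e q : α) ∈ upperBounds ((fun q : ℚ => (e q : α)) '' {q | q < s}) := by
      rintro q hq _ ⟨q', hq', rfl⟩
      have : q' < q := by exact_mod_cast (lt_trans hq' hq : (q' : ℝ) < q)
      exact e.monotone this.le
    exact ⟨sSup ((fun q : ℚ => (e q : α)) '' {q | q < s}), fun q =>
      ⟨fun hq => le_csSup ⟨_, hub q₁ hq₁⟩ ⟨q, hq, rfl⟩,
        fun hq => csSup_le ⟨_, q₀, hq₀, rfl⟩ (hub q hq)⟩⟩
  choose z hz using hz
  refine not_pairwiseDisjoint_Ioo (S := Set.univ) Set.not_countable_univ (fun s => F (a, z s))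
    (fun s => F (b, z s)) (fun s _ => hinc.1 _ hlt) fun s _ t _ hst => ?_
  obtain ⟨q, hsq, hqt⟩ := exists_rat_btwn hst
  obtain ⟨q', hqq', hqt'⟩ := exists_rat_btwn hqt
  have hq : q < q' := by exact_mod_cast hqq'
  have h1 : z s ≤ e q := (hz s q).2 hsq
  have h2 : (e q : α) < e q' := e.strictMono hq
  have h3 : (e q' : α) ≤ z t := (hz t q').1 hqt'
  -- An overlap puts `F (a, z t)` between the symmetric points `F (a, z s)` and `F (b, z s)`.
  -- Cancelling `a` makes `z s`, `z t` equivalent, although two distinct representatives lie between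
  -- them.
  by_contra! h
  have h4 : SymmetricAt F (F (a, z s)) (F (a, z t)) :=
    hconv (hinc.map_le_map le_rfl (h1.trans (h2.le.trans h3))) h.le
      (hab.map hbis (u := z s) (v := z s) rfl)
  have h5 : SymmetricAt F (z s) (z t) := h4.of_map_left hbis hinc
  exact h2.ne (congrArg _ (huniq _ _ (hconv h2.le h3 (hconv' h1 (h2.le.trans h3) h5))))

end Complete

end BinaryMap

theorem corollary3p2 (I : Set ℝ) (hI : IsProperInterval I) (F : I × I → I)
    (hbis : BinaryMap.Bisymmetric F) (hinc : BinaryMap.PartiallyStrictlyIncreasing F)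
    (hrefl : BinaryMap.Reflexive F) :
    (BinaryMap.Symmetric F ∨ BinaryMap.NowhereSymmetric F) ∧
      ¬ (BinaryMap.Symmetric F ∧ BinaryMap.NowhereSymmetric F) := by
  obtain ⟨hconn, hint⟩ := hI
  obtain ⟨x, hx, y, hy, hxy⟩ := (infinite_of_mem_nhds hint.some
    (mem_interior_iff_mem_nhds.1 hint.some_mem)).nontrivial
  have : Inhabited I := ⟨⟨x, hx⟩⟩
  have : Set.OrdConnected I := hconn
  refine ⟨?_, fun h => h.2 ⟨x, hx⟩ ⟨y, hy⟩ (fun h' => hxy (congrArg Subtype.val h')) (h.1 _ _)⟩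
  refine or_iff_not_imp_right.2 fun h => ?_
  simp only [BinaryMap.NowhereSymmetric, not_forall, not_not] at h
  obtain ⟨a, b, hne, hab⟩ := h
  rcases hne.lt_or_gt with hlt | hlt
  · exact BinaryMap.symmetric_of_symmetricAt hbis hinc hrefl hlt hab
  · exact BinaryMap.symmetric_of_symmetricAt hbis hinc hrefl hlt hab.symm
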